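/- **Setting.** Closed terms $t$, stacks $\pi$ and processes $t\star\pi$ of the $\lambda_c$-calculus are given by: $\lambda_c$-terms are variables, applications $tu$, abstractions $\lambda x.t$, the constant $\mathsf{cc}$, continuation constants $k_\pi$ ($\pi$ a stack), nonrestricted instructions $a_m$ and restricted instructions $b_m$ ($m\in\mathbb N$), modulo $\alpha$-equivalence; stacks are $\omega_m$ ($m\in\mathbb N$) or $t\cdot\pi$ with $t$ a closed term. One-step evaluation $\succ_1$ is: $tu\star\pi\succ_1 t\star u\cdot\pi$; $\lambda x.t\star u\cdot\pi\succ_1 t[x:=u]\star\pi$; $\mathsf{cc}\star t\cdot\pi\succ_1 t\star k_\pi\cdot\pi$; $k_{\pi'}\star t\cdot\pi\succ_1 t\star\pi'$. A *pole* is a set $\bot\!\!\!\bot$ of processes such that $p\succ_1 q\in\bot\!\!\!\bot$ implies $p\in\bot\!\!\!\bot$; a *realizability structure* $\mathcal S$ is a set of poles. A term is *proof-like* if it contains no $k_\pi$ and no $b_m$. Formulas are second-order formulas over first-order terms built from variables and all functions $\mathbb N^k\to\mathbb N$, with connectives $\top,\bot,A\to B,\forall x\,A,\forall X\,A$, equational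 implication $(a=b)\mapsto A$, $A\cap B$, $A\cup B$, and constant predicates $F:\mathbb N^k\to\mathcal P(\Pi)$, where $\Pi$ is the set of stacks. For a pole $\bot\!\!\!\bot$, falsity values are: $\|\top\|=\emptyset$, $\|\bot\|=\Pi$, $\|A\to B\|=\{t\cdot\pi : t\in|A|,\ \pi\in\|B\|\}$, $\|\forall x\,A\|=\bigcup_{m\in\mathbb N}\|A[x:=m]\|$, $\|\forall X\,A\|=\bigcup_{F:\mathbb N^k\to\mathcal P(\Pi)}\|A[X:=F]\|$ ($X$ of arity $k$), $\|(a=b)\mapsto A\|=\|A\|$ if $a$ and $b$ have the same value and $\emptyset$ otherwise, $\|A\cap B\|=\|A\|\cup\|B\|$, $\|A\cup B\|=\|A\|\cap\|B\|$, and $\|F(a_1,\dots,a_k)\|$ is $F$ at the values of the $a_i$; here $|A|=\{t \text{ closed}: \forall\pi\in\|A\|,\ t\star\pi\in\bot\!\!\!\bot\}$. The *theory* $\mathrm{Th}(\mathcal S)$ is the set of closed formulas $A$ for which one proof-like closed term belongs to $|A|$ for every pole in $\mathcal S$; write $\mathrm{Th}(\mathcal S)\models A$ for $A\in\mathrm{Th}(\mathcal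 S)$. Let $a=b$ stand for $\forall Z\,(Z(a)\to Z(b))$, let $A\vee B$ stand for $\forall Z\,((A\to Z)\to(B\to Z)\to Z)$, and let $\forall x^{\gimel 2}A$ stand for $\forall x\,\bigl((\min(x+1,2)=x+1)\mapsto A\bigr)$. For a positive integer $m$, $|\gimel 2|<m$ denotes the closed formula $\forall x_1^{\gimel 2}\cdots\forall x_m^{\gimel 2}\ \bigvee_{i\ne j}(x_i=x_j)$ (an empty disjunction being $\bot$), and $|\gimel 2|\le m$ denotes $|\gimel 2|<m+1$. The *evaluation relation associated with* $\mathcal S$ is the relation on sets of processes defined by: $P\succ_{\mathcal S}Q$ if and only if for every $\bot\!\!\!\bot\in\mathcal S$, $Q\subseteq\bot\!\!\!\bot$ implies $P\cap\bot\!\!\!\bot\neq\emptyset$. For a positive integer $n$, an *$n$-voting instruction modulo* $\succ_{\mathcal S}$ is a closed term $\phi$ such that for all closed terms $t_1,\dots,t_n$, all stacks $\pi$ and all $j\in\{1,\dots,n\}$, $$\{\phi\star t_1\cdot\ldots\cdot t_n\cdot\pi\}\ \succ_{\mathcal S}\ \{t_i\star\pi : i\ne j\}.$$ **Statement.** Let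 $\mathcal S$ be a realizability structure and $n$ a positive integer. Then $\mathrm{Th}(\mathcal S)\models |\gimel 2|<2^n$ if and only if there is a proof-like $n$-voting instruction modulo $\succ_{\mathcal S}$. Likewise, $\mathrm{Th}(\mathcal S)\models |\gimel 2|\le 2^{n-1}$ if and only if there is a proof-like $n$-voting instruction modulo $\succ_{\mathcal S}$. -/

import Mathlib

namespace ClassicalRealizability

/-! ### The calculus

Terms are taken modulo renaming of bound variables, through well-scoped de Bruijn indices:
`LTerm k` is the type of terms whose free variables are among `k` given ones. -/

mutual
  /-- Terms of the calculus with at most `k` free variables. -/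
  inductive LTerm : ℕ → Type
    | var {k : ℕ} (i : Fin k) : LTerm k
    | app {k : ℕ} (t u : LTerm k) : LTerm k
    | lam {k : ℕ} (t : LTerm (k + 1)) : LTerm k
    | callcc {k : ℕ} : LTerm k
    | cont {k : ℕ} (π : Stack) : LTerm k
    | instrA {k : ℕ} (m : ℕ) : LTerm k
    | instrB {k : ℕ} (m : ℕ) : LTerm k

  /-- Stacks: a stack bottom below finitely many closed terms. -/
  inductive Stack : Type
    | bottom (m : ℕ) : Stack
    | push (t : LTerm 0) (π : Stack) : Stack
end

/-- Closed terms. -/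
abbrev Term : Type := LTerm 0

namespace LTerm

/-- Renaming of free variables. -/
def rename : {k l : ℕ} → (Fin k → Fin l) → LTerm k → LTerm l
  | _, _, r, var i => var (r i)
  | _, _, r, app t u => app (rename r t) (rename r u)
  | _, _, r, lam t => lam (rename (Fin.cases 0 (fun i => (r i).succ)) t)
  | _, _, _, callcc => callcc
  | _, _, _, cont π => cont π
  | _, _, _, instrA m => instrA m
  | _, _, _, instrB m => instrB m

/-- Simultaneous capture-avoiding substitution. -/
def subst : {k l : ℕ} → (Fin k → LTerm l) → LTerm k → LTerm l
  | _, _, s, var i => s i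
  | _, _, s, app t u => app (subst s t) (subst s u)
  | _, _, s, lam t => lam (subst (Fin.cases (var 0) (fun i => rename Fin.succ (s i))) t)
  | _, _, _, callcc => callcc
  | _, _, _, cont π => cont π
  | _, _, _, instrA m => instrA m
  | _, _, _, instrB m => instrB m

/-- A term is proof-like if it contains no continuation constant and no restricted
instruction (`instrB`). -/
def ProofLike : {k : ℕ} → LTerm k → Prop
  | _, var _ => True
  | _, app t u => ProofLike t ∧ ProofLike u
  | _, lam t => ProofLike t
  | _, callcc => True
  | _, cont _ => False
  | _, instrA _ => True
  | _, instrB _ => False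

end LTerm

/-- Processes `t ⋆ π`. -/
structure Proc : Type where
  head : Term
  stack : Stack

/-- `pushAll t π` is the stack `t₁ · … · tₙ · π`. -/
def pushAll {n : ℕ} (t : Fin n → Term) (π : Stack) : Stack :=
  (List.ofFn t).foldr Stack.push π

/-- One-step evaluation: the rules push, grab, save and restore. -/
inductive Step : Proc → Proc → Prop
  | push (t u : Term) (π : Stack) : Step ⟨.app t u, π⟩ ⟨t, .push u π⟩
  | grab (t : LTerm 1) (u : Term) (π : Stack) :
      Step ⟨.lam t, .push u π⟩ ⟨t.subst (fun _ => u), π⟩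
  | save (t : Term) (π : Stack) : Step ⟨.callcc, .push t π⟩ ⟨t, .push (.cont π) π⟩
  | restore (t : Term) (π π' : Stack) : Step ⟨.cont π', .push t π⟩ ⟨t, π'⟩

/-- Evaluation: the smallest preorder containing one-step evaluation. -/
def Eval : Proc → Proc → Prop := Relation.ReflTransGen Step

/-! ### The realizability language

First-order terms and formulas are again taken modulo renaming of bound variables. -/

/-- First-order terms with at most `k` free variables; every function `ℕⁿ → ℕ` is a symbol. -/
inductive FOTerm (k : ℕ) : Type
  | var (i : Fin k) : FOTerm k
  | app (n : ℕ) (f : (Fin n → ℕ) → ℕ) (a : Fin n → FOTerm k) : FOTerm k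

/-- The value of a first-order term, given values of its free variables. -/
def FOTerm.value {k : ℕ} (ρ : Fin k → ℕ) : FOTerm k → ℕ
  | .var i => ρ i
  | .app _ f a => f (fun i => (a i).value ρ)

/-- `PVar Γ n` is the type of `n`-ary propositional variables in a scope `Γ`, the list of the
arities of the variables in scope. -/
inductive PVar : List ℕ → ℕ → Type
  | zero {Γ : List ℕ} {n : ℕ} : PVar (n :: Γ) n
  | succ {Γ : List ℕ} {m n : ℕ} (X : PVar Γ n) : PVar (m :: Γ) n

/-- Formulas with at most `k` free first-order variables, and with free propositional variables
in `Γ`. In `all₁` and `all₂` the bound variable is the one with index zero. -/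
inductive Formula : ℕ → List ℕ → Type
  | pvar {k : ℕ} {Γ : List ℕ} {n : ℕ} (X : PVar Γ n) (a : Fin n → FOTerm k) : Formula k Γ
  | top {k : ℕ} {Γ : List ℕ} : Formula k Γ
  | bot {k : ℕ} {Γ : List ℕ} : Formula k Γ
  | imp {k : ℕ} {Γ : List ℕ} (A B : Formula k Γ) : Formula k Γ
  | all₁ {k : ℕ} {Γ : List ℕ} (A : Formula (k + 1) Γ) : Formula k Γ
  | all₂ {k : ℕ} {Γ : List ℕ} (n : ℕ) (A : Formula k (n :: Γ)) : Formula k Γ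
  /-- equational implication -/
  | eqImp {k : ℕ} {Γ : List ℕ} (a b : FOTerm k) (A : Formula k Γ) : Formula k Γ
  | inter {k : ℕ} {Γ : List ℕ} (A B : Formula k Γ) : Formula k Γ
  | union {k : ℕ} {Γ : List ℕ} (A B : Formula k Γ) : Formula k Γ
  /-- a constant predicate `F : ℕⁿ → 𝒫(Π)` applied to first-order terms -/
  | const {k : ℕ} {Γ : List ℕ} (n : ℕ) (F : (Fin n → ℕ) → Set Stack) (a : Fin n → FOTerm k) :
      Formula k Γ

/-- Closed formulas. -/
abbrev ClosedFormula : Type := Formula 0 []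

/-- A renaming of propositional variables, extended under a binder. -/
def PVar.lift {Γ Δ : List ℕ} {m : ℕ} (r : ∀ n, PVar Γ n → PVar Δ n) :
    ∀ n, PVar (m :: Γ) n → PVar (m :: Δ) n
  | _, .zero => .zero
  | _, .succ X => .succ (r _ X)

namespace Formula

/-- Renaming of free propositional variables. -/
def rename : {k : ℕ} → {Γ Δ : List ℕ} → (∀ n, PVar Γ n → PVar Δ n) → Formula k Γ → Formula k Δ
  | _, _, _, r, pvar X a => pvar (r _ X) a
  | _, _, _, _, top => top
  | _, _, _, _, bot => bot
  | _, _, _, r, imp A B => imp (rename r A) (rename r B)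
  | _, _, _, r, all₁ A => all₁ (rename r A)
  | _, _, _, r, all₂ n A => all₂ n (rename (PVar.lift r) A)
  | _, _, _, r, eqImp a b A => eqImp a b (rename r A)
  | _, _, _, r, inter A B => inter (rename r A) (rename r B)
  | _, _, _, r, union A B => union (rename r A) (rename r B)
  | _, _, _, _, const n F a => const n F a

/-- `A`, seen in a scope with one more propositional variable, which does not occur in it. -/
def weaken {k : ℕ} {Γ : List ℕ} (m : ℕ) (A : Formula k Γ) : Formula k (m :: Γ) :=
  A.rename (fun _ X => .succ X)

/-- `a = b` is `∀ Z, Z(a) → Z(b)`. -/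
def eq {k : ℕ} {Γ : List ℕ} (a b : FOTerm k) : Formula k Γ :=
  all₂ 1 (imp (pvar .zero ![a]) (pvar .zero ![b]))

/-- `a ≠ b` is the equational implication from `a = b` to `⊥`. -/
def ne {k : ℕ} {Γ : List ℕ} (a b : FOTerm k) : Formula k Γ := eqImp a b bot

/-- `A ∧ B` is `∀ Z, (A → B → Z) → Z`. -/
def and {k : ℕ} {Γ : List ℕ} (A B : Formula k Γ) : Formula k Γ :=
  all₂ 0 (imp (imp (A.weaken 0) (imp (B.weaken 0) (pvar .zero ![]))) (pvar .zero ![]))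

/-- `A ∨ B` is `∀ Z, (A → Z) → (B → Z) → Z`. -/
def or {k : ℕ} {Γ : List ℕ} (A B : Formula k Γ) : Formula k Γ :=
  all₂ 0 (imp (imp (A.weaken 0) (pvar .zero ![]))
    (imp (imp (B.weaken 0) (pvar .zero ![])) (pvar .zero ![])))

end Formula

/-! ### Realizability -/

/-- Poles: sets of processes closed under anti-evaluation. -/
structure Pole : Type where
  carrier : Set Proc
  anti_eval : ∀ p q : Proc, Eval p q → q ∈ carrier → p ∈ carrier

/-- The dual of a set of stacks with respect to a pole. -/
def Pole.dual (P : Pole) (X : Set Stack) : Set Term :=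
  {t | ∀ π ∈ X, (⟨t, π⟩ : Proc) ∈ P.carrier}

/-- An assignment of values to the propositional variables in scope. -/
def PEnv (Γ : List ℕ) : Type := ∀ n, PVar Γ n → (Fin n → ℕ) → Set Stack

/-- The assignment in the empty scope. -/
def PEnv.empty : PEnv [] := fun _ X => nomatch X

/-- Extension of an assignment by a value of the variable with index zero. -/
def PEnv.cons {Γ : List ℕ} {m : ℕ} (F : (Fin m → ℕ) → Set Stack) (σ : PEnv Γ) : PEnv (m :: Γ)
  | _, .zero => F
  | _, .succ X => σ _ X

/-- The falsity value of a formula with respect to a pole, given values of its free variables. -/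
def falsity (P : Pole) : {k : ℕ} → {Γ : List ℕ} → Formula k Γ → (Fin k → ℕ) → PEnv Γ → Set Stack
  | _, _, .pvar X a, ρ, σ => σ _ X (fun i => (a i).value ρ)
  | _, _, .top, _, _ => ∅
  | _, _, .bot, _, _ => Set.univ
  | _, _, .imp A B, ρ, σ =>
      {ξ | ∃ t ∈ P.dual (falsity P A ρ σ), ∃ π ∈ falsity P B ρ σ, ξ = .push t π}
  | _, _, .all₁ A, ρ, σ => ⋃ m : ℕ, falsity P A (Fin.cons m ρ) σ
  | _, _, .all₂ n A, ρ, σ => ⋃ F : (Fin n → ℕ) → Set Stack, falsity P A ρ (σ.cons F)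
  | _, _, .eqImp a b A, ρ, σ => {π | a.value ρ = b.value ρ ∧ π ∈ falsity P A ρ σ}
  | _, _, .inter A B, ρ, σ => falsity P A ρ σ ∪ falsity P B ρ σ
  | _, _, .union A B, ρ, σ => falsity P A ρ σ ∩ falsity P B ρ σ
  | _, _, .const _ F a, ρ, _ => F (fun i => (a i).value ρ)

/-- The term `t` realizes the closed formula `A` with respect to the pole `P`. -/
def Realizes (P : Pole) (t : Term) (A : ClosedFormula) : Prop :=
  t ∈ P.dual (falsity P A Fin.elim0 PEnv.empty)

/-- A realizability structure is a set of poles. -/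
abbrev RealizabilityStructure : Type := Set Pole

/-- The theory generated by a realizability structure: the closed formulas that have a common
proof-like realizer for all its poles. -/
def theory (S : RealizabilityStructure) : Set ClosedFormula :=
  {A | ∃ t : Term, t.ProofLike ∧ ∀ P ∈ S, Realizes P t A}

/-! ### The characteristic Boolean algebra and its cardinality -/

/-- Terms of the language of Boolean algebras. -/
inductive BATerm (k : ℕ) : Type
  | var (i : Fin k) : BATerm k
  | zero : BATerm k
  | one : BATerm k
  | sup (a b : BATerm k) : BATerm k
  | inf (a b : BATerm k) : BATerm k
  | compl (a : BATerm k) : BATerm k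

/-- Formulas of the language of Boolean algebras. -/
inductive BAFormula : ℕ → Type
  | top {k : ℕ} : BAFormula k
  | bot {k : ℕ} : BAFormula k
  | ne {k : ℕ} (a b : BATerm k) : BAFormula k
  | eq {k : ℕ} (a b : BATerm k) : BAFormula k
  | imp {k : ℕ} (A B : BAFormula k) : BAFormula k
  | or {k : ℕ} (A B : BAFormula k) : BAFormula k
  | and {k : ℕ} (A B : BAFormula k) : BAFormula k
  | all {k : ℕ} (A : BAFormula (k + 1)) : BAFormula k

/-- The Boolean operations extended to all natural numbers, as first-order function symbols. -/
def BATerm.toFO {k : ℕ} : BATerm k → FOTerm k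
  | .var i => .var i
  | .zero => .app 0 (fun _ => 0) ![]
  | .one => .app 0 (fun _ => 1) ![]
  | .sup a b => .app 2 (fun v => if 0 < v 0 ∨ 0 < v 1 then 1 else 0) ![a.toFO, b.toFO]
  | .inf a b => .app 2 (fun v => if 0 < v 0 ∧ 0 < v 1 then 1 else 0) ![a.toFO, b.toFO]
  | .compl a => .app 1 (fun v => if v 0 = 0 then 1 else 0) ![a.toFO]

/-- The quantifier `∀ x` relativized to `ℷ n`: the predicate `ℷ n (x)` is the equation
`min (x + 1, n) = x + 1`, and it is put in front of the formula by an equational implication. -/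
def Formula.allGimel {k : ℕ} {Γ : List ℕ} (n : ℕ) (A : Formula (k + 1) Γ) : Formula k Γ :=
  let x : FOTerm (k + 1) := .var 0
  let one : FOTerm (k + 1) := .app 0 (fun _ => 1) ![]
  let bd : FOTerm (k + 1) := .app 0 (fun _ => n) ![]
  let x1 : FOTerm (k + 1) := .app 2 (fun v => v 0 + v 1) ![x, one]
  .all₁ (.eqImp (.app 2 (fun v => min (v 0) (v 1)) ![x1, bd]) x1 A)

/-- The formula `ℷ2 ⊨ A`: all quantifiers of `A` are relativized to `ℷ2`. -/
def BAFormula.inGimelTwo : {k : ℕ} → BAFormula k → Formula k []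
  | _, .top => .top
  | _, .bot => .bot
  | _, .ne a b => .ne a.toFO b.toFO
  | _, .eq a b => .eq a.toFO b.toFO
  | _, .imp A B => .imp A.inGimelTwo B.inGimelTwo
  | _, .or A B => .or A.inGimelTwo B.inGimelTwo
  | _, .and A B => .and A.inGimelTwo B.inGimelTwo
  | _, .all A => .allGimel 2 A.inGimelTwo

/-- The disjunction of a list of formulas, associated to the left (`⊥` for the empty list). -/
def BAFormula.bigOr {k : ℕ} : List (BAFormula k) → BAFormula k
  | [] => .bot
  | A :: l => l.foldl .or A

/-- Universal closure. -/
def BAFormula.allClosure : (k : ℕ) → BAFormula k → BAFormula 0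
  | 0, A => A
  | k + 1, A => allClosure k (.all A)

/-- `∀ x₁ … xₘ, ⋁_{i ≠ j} xᵢ = xⱼ`, the formula saying that there are fewer than `m` elements. -/
def BAFormula.cardLT (m : ℕ) : BAFormula 0 :=
  allClosure m (bigOr
    (((List.finRange m ×ˢ List.finRange m).filter (fun p => p.1 ≠ p.2)).map
      (fun p => .eq (.var p.1) (.var p.2))))

/-- The closed formula `|ℷ2| < m`. -/
def gimelTwoCardLT (m : ℕ) : ClosedFormula := (BAFormula.cardLT m).inGimelTwo

/-- The closed formula `|ℷ2| ≤ m`, that is, `|ℷ2| < m + 1`. -/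
def gimelTwoCardLE (m : ℕ) : ClosedFormula := gimelTwoCardLT (m + 1)

/-! ### Multi-evaluation relations -/

/-- Multi-evaluation relations. -/
structure EvaluationRelation : Type where
  rel : Set Proc → Set Proc → Prop
  step : ∀ p q : Proc, Step p q → rel {p} {q}
  identity : ∀ p : Proc, rel {p} {p}
  cut : ∀ (P Q P' Q' : Set Proc) (r : Proc),
    rel P (Q ∪ {r}) → rel (P' ∪ {r}) Q' → rel (P ∪ P') (Q ∪ Q')
  weakening : ∀ P Q P' Q' : Set Proc, rel P Q → P ⊆ P' → Q ⊆ Q' → rel P' Q'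

/-- The evaluation relation associated with a realizability structure. -/
def evaluationOf (S : RealizabilityStructure) : EvaluationRelation where
  rel P Q := ∀ R ∈ S, Q ⊆ R.carrier → (P ∩ R.carrier).Nonempty
  step p q h R _ hq :=
    ⟨p, rfl, R.anti_eval p q (Relation.ReflTransGen.single h) (hq rfl)⟩
  identity p _ _ hp := ⟨p, rfl, hp rfl⟩
  cut P Q P' Q' r h h' R hR hQ := by
    obtain ⟨hQ1, hQ2⟩ := Set.union_subset_iff.1 hQ
    by_cases hr : r ∈ R.carrier
    · obtain ⟨p, hp, hpR⟩ := h R hR (Set.union_subset hQ1 (Set.singleton_subset_iff.2 hr))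
      exact ⟨p, Or.inl hp, hpR⟩
    · obtain ⟨p, hp, hpR⟩ := h' R hR hQ2
      rcases hp with hp | hp
      · exact ⟨p, Or.inr hp, hpR⟩
      · exact absurd (Set.mem_singleton_iff.1 hp ▸ hpR) hr
  weakening _ _ _ _ h hP hQ R hR hQ' :=
    (h R hR (hQ.trans hQ')).mono (Set.inter_subset_inter_left _ hP)

/-- The closed term `φ` is an `n`-voting instruction modulo the evaluation relation `E`. -/
def IsVotingInstruction (E : EvaluationRelation) (n : ℕ) (φ : Term) : Prop :=
  ∀ (t : Fin n → Term) (π : Stack) (j : Fin n),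
    E.rel {⟨φ, pushAll t π⟩} {p | ∃ i : Fin n, i ≠ j ∧ p = ⟨t i, π⟩}

end ClassicalRealizability

/-!
The falsity value of `|ℷ2| < m` is the union, over the assignments `x : Fin m → {0, 1}`, of the
falsity values of the disjunction of the equations `xₐ = xᵦ`. An equation between equal values is
realized by the identity, while a realizer of an equation between different values realizes `⊤ → ⊥`.
So a proof-like realizer of `|ℷ2| < m` is a term which works for all the assignments at once,
without having access to them. Both equivalences follow from two implications.

If `m ≤ 2 ^ n` and `θ` realizes `|ℷ2| < m` (`exists_votingInstruction`), choose distinct subsets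
`f a` of `Fin n`, for `a < m`, and for `a ≠ b` an index `i a b` in exactly one of `f a` and `f b`.
The voting instruction takes `t₁, …, tₙ` and analyses `θ`, passing `t (i a b)` to the realizer it
receives of the equation `xₐ = xᵦ`. It is correct when only `t j` is wrong, by considering the
assignment `xₐ = 1 ↔ j ∈ f a`: if `i a b = j`, the equation is between different values, and its
realizer accepts any argument.

If `2 ^ (n - 1) < m` and `φ` is an `n`-voting instruction (`gimelTwoCardLT_mem_theory`), then for each
set `V` of assignments there is a proof-like term realizing the disjunction at all of them
(`exists_mem_truth_someEq`). When `V` has fewer than `n` elements, two variables agree at all of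
them by the pigeonhole principle, and an injection of the identity into the disjunction will do.
Otherwise take distinct `s₁, …, sₙ` in `V` and apply `φ` to the terms obtained inductively for the
sets `V \ {sᵢ}`: at a given assignment, at most one of these is wrong.
-/

namespace ClassicalRealizability

/-! ### Substitution -/

namespace LTerm

theorem rename_congr {k l : ℕ} {r r' : Fin k → Fin l} (h : ∀ i, r i = r' i) (t : LTerm k) :
    t.rename r = t.rename r' := by
  rw [funext h]

theorem subst_congr {k l : ℕ} {s s' : Fin k → LTerm l} (h : ∀ i, s i = s' i) (t : LTerm k) :
    t.subst s = t.subst s' := by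
  rw [funext h]

theorem rename_rename : ∀ {k l m : ℕ} (r : Fin k → Fin l) (r' : Fin l → Fin m) (t : LTerm k),
    (t.rename r).rename r' = t.rename (fun i => r' (r i))
  | _, _, _, _, _, var _ => rfl
  | _, _, _, r, r', app t u => by simp only [rename, rename_rename r r']
  | _, _, _, r, r', lam t => by
      simp only [rename, rename_rename]
      congr 1
      exact rename_congr (fun i => by cases i using Fin.cases <;> rfl) t
  | _, _, _, _, _, callcc => rfl
  | _, _, _, _, _, cont _ => rfl
  | _, _, _, _, _, instrA _ => rfl
  | _, _, _, _, _, instrB _ => rfl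

theorem subst_rename : ∀ {k l m : ℕ} (r : Fin k → Fin l) (s : Fin l → LTerm m) (t : LTerm k),
    (t.rename r).subst s = t.subst (fun i => s (r i))
  | _, _, _, _, _, var _ => rfl
  | _, _, _, r, s, app t u => by simp only [rename, subst, subst_rename r s]
  | _, _, _, r, s, lam t => by
      simp only [rename, subst, subst_rename]
      congr 1
      exact subst_congr (fun i => by cases i using Fin.cases <;> rfl) t
  | _, _, _, _, _, callcc => rfl
  | _, _, _, _, _, cont _ => rfl
  | _, _, _, _, _, instrA _ => rfl
  | _, _, _, _, _, instrB _ => rfl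

theorem rename_subst : ∀ {k l m : ℕ} (s : Fin k → LTerm l) (r : Fin l → Fin m) (t : LTerm k),
    (t.subst s).rename r = t.subst (fun i => (s i).rename r)
  | _, _, _, _, _, var _ => rfl
  | _, _, _, s, r, app t u => by simp only [rename, subst, rename_subst s r]
  | _, _, _, s, r, lam t => by
      simp only [rename, subst, rename_subst]
      congr 1
      refine subst_congr (fun i => ?_) t
      cases i using Fin.cases
      · rfl
      · simp only [Fin.cases_succ, rename_rename]
  | _, _, _, _, _, callcc => rfl
  | _, _, _, _, _, cont _ => rfl
  | _, _, _, _, _, instrA _ => rfl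
  | _, _, _, _, _, instrB _ => rfl

theorem subst_subst : ∀ {k l m : ℕ} (s : Fin k → LTerm l) (s' : Fin l → LTerm m) (t : LTerm k),
    (t.subst s).subst s' = t.subst (fun i => (s i).subst s')
  | _, _, _, _, _, var _ => rfl
  | _, _, _, s, s', app t u => by simp only [subst, subst_subst s s']
  | _, _, _, s, s', lam t => by
      simp only [subst, subst_subst]
      congr 1
      refine subst_congr (fun i => ?_) t
      cases i using Fin.cases
      · rfl
      · simp only [Fin.cases_succ, subst_rename, rename_subst]
  | _, _, _, _, _, callcc => rfl
  | _, _, _, _, _, cont _ => rfl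
  | _, _, _, _, _, instrA _ => rfl
  | _, _, _, _, _, instrB _ => rfl

theorem subst_eq_self : ∀ {k : ℕ} {s : Fin k → LTerm k} (_ : ∀ i, s i = var i) (t : LTerm k),
    t.subst s = t
  | _, _, h, var i => h i
  | _, _, h, app t u => by simp only [subst, subst_eq_self h]
  | _, s, h, lam t => by
      simp only [subst]
      congr 1
      refine subst_eq_self (fun i => ?_) t
      cases i using Fin.cases
      · rfl
      · simp only [Fin.cases_succ, h, rename]
  | _, _, _, callcc => rfl
  | _, _, _, cont _ => rfl
  | _, _, _, instrA _ => rfl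
  | _, _, _, instrB _ => rfl

theorem proofLike_rename : ∀ {k l : ℕ} (r : Fin k → Fin l) {t : LTerm k},
    t.ProofLike → (t.rename r).ProofLike
  | _, _, _, var _, _ => trivial
  | _, _, r, app _ _, h => ⟨proofLike_rename r h.1, proofLike_rename r h.2⟩
  | _, _, _, lam t, h => proofLike_rename (t := t) _ h
  | _, _, _, callcc, _ => trivial
  | _, _, _, cont _, h => h
  | _, _, _, instrA _, _ => trivial
  | _, _, _, instrB _, h => h

/-- A closed term, weakened to a larger scope, is not affected by substitution there. -/
theorem subst_rename_closed {k : ℕ} (t : Term) (r : Fin 0 → Fin k) (s : Fin k → Term) :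
    (t.rename r).subst s = t := by
  rw [subst_rename]
  exact subst_eq_self (fun i => i.elim0) t

/-- Iterated abstraction over all the free variables, the one of index zero being bound
innermost. -/
def lams : (k : ℕ) → LTerm k → Term
  | 0, t => t
  | k + 1, t => lams k (lam t)

theorem proofLike_lams : ∀ {k : ℕ} {t : LTerm k}, t.ProofLike → (lams k t).ProofLike
  | 0, _, h => h
  | _ + 1, t, h => proofLike_lams (t := lam t) h

end LTerm

open LTerm

/-! ### Evaluation of iterated abstractions and applications -/

theorem eval_lam_subst {k : ℕ} (t : LTerm (k + 1)) (s : Fin k → Term) (u : Term) (π : Stack) :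
    Eval ⟨(lam t).subst s, .push u π⟩ ⟨t.subst (Fin.cases u s), π⟩ := by
  have h := Step.grab (t.subst (Fin.cases (var 0) (fun i => (s i).rename Fin.succ))) u π
  rw [subst_subst] at h
  have h' : t.subst (fun i => (Fin.cases (motive := fun _ => LTerm 1) (var 0)
      (fun i => (s i).rename Fin.succ) i).subst (fun _ => u)) = t.subst (Fin.cases u s) := by
    refine subst_congr (fun i => ?_) t
    cases i using Fin.cases
    · rfl
    · simp only [Fin.cases_succ, subst_rename_closed]
  rw [h'] at h
  exact .single h

theorem pushAll_succ {k : ℕ} (t : Fin (k + 1) → Term) (π : Stack) :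
    pushAll t π = pushAll (fun i => t i.castSucc) (.push (t (Fin.last k)) π) := by
  simp only [pushAll, List.ofFn_succ', List.concat_eq_append, List.foldr_append,
    List.foldr_cons, List.foldr_nil]

/-- The arguments on the stack are bound in reverse order, because the bottommost of them is
grabbed by the innermost abstraction. -/
theorem eval_lams : ∀ {k : ℕ} (b : LTerm k) (t : Fin k → Term) (π : Stack),
    Eval ⟨lams k b, pushAll t π⟩ ⟨b.subst (fun i => t i.rev), π⟩
  | 0, b, t, π => by
      rw [subst_eq_self (fun i => i.elim0)]
      exact .refl
  | k + 1, b, t, π => by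
      rw [pushAll_succ]
      refine (eval_lams (lam b) _ _).trans ?_
      have h := eval_lam_subst b (fun i => t i.rev.castSucc) (t (Fin.last k)) π
      rwa [subst_congr (s' := fun i => t i.rev) (fun i => ?_) b] at h
      cases i using Fin.cases
      · simp
      · simp [Fin.rev_succ]

/-- Application to several arguments. -/
def apps (f : Term) : List Term → Term
  | [] => f
  | t :: l => apps (app f t) l

theorem proofLike_apps {f : Term} (hf : f.ProofLike) {l : List Term}
    (hl : ∀ t ∈ l, t.ProofLike) : (apps f l).ProofLike := by
  induction l generalizing f with
  | nil => exact hf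
  | cons t l ih =>
    exact ih ⟨hf, hl t (by simp)⟩ (fun u hu => hl u (by simp [hu]))

theorem eval_apps (f : Term) (l : List Term) (π : Stack) :
    Eval ⟨apps f l, π⟩ ⟨f, l.foldr Stack.push π⟩ := by
  induction l generalizing f with
  | nil => exact .refl
  | cons t l ih => exact (ih (app f t)).trans (.single (.push f t _))

/-! ### Realizers of the connectives -/

theorem falsity_rename (P : Pole) {k : ℕ} {Γ : List ℕ} (A : Formula k Γ) :
    ∀ {Δ : List ℕ} (r : ∀ n, PVar Γ n → PVar Δ n) (ρ : Fin k → ℕ) (σ : PEnv Γ) (τ : PEnv Δ),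
      (∀ n X, τ n (r n X) = σ n X) → falsity P (A.rename r) ρ τ = falsity P A ρ σ := by
  induction A with
  | pvar X a => intro Δ r ρ σ τ h; simp only [Formula.rename, falsity, h]
  | top => intros; rfl
  | bot => intros; rfl
  | imp A B ihA ihB =>
    intro Δ r ρ σ τ h; simp only [Formula.rename, falsity, ihA r ρ σ τ h, ihB r ρ σ τ h]
  | all₁ A ih =>
    intro Δ r ρ σ τ h
    simp only [Formula.rename, falsity]
    exact Set.iUnion_congr fun m => ih r _ σ τ h
  | all₂ n A ih =>
    intro Δ r ρ σ τ h
    simp only [Formula.rename, falsity]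
    refine Set.iUnion_congr fun F => ih _ _ _ _ ?_
    intro n X
    cases X with
    | zero => rfl
    | succ X => exact h _ X
  | eqImp a b A ih => intro Δ r ρ σ τ h; simp only [Formula.rename, falsity, ih r ρ σ τ h]
  | inter A B ihA ihB =>
    intro Δ r ρ σ τ h; simp only [Formula.rename, falsity, ihA r ρ σ τ h, ihB r ρ σ τ h]
  | union A B ihA ihB =>
    intro Δ r ρ σ τ h; simp only [Formula.rename, falsity, ihA r ρ σ τ h, ihB r ρ σ τ h]
  | const n F a => intros; rfl

theorem falsity_weaken (P : Pole) {k m : ℕ} {Γ : List ℕ} (A : Formula k Γ) (ρ : Fin k → ℕ)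
    (σ : PEnv Γ) (F : (Fin m → ℕ) → Set Stack) :
    falsity P (A.weaken m) ρ (σ.cons F) = falsity P A ρ σ :=
  falsity_rename P A _ ρ σ _ (fun _ _ => rfl)

/-- The truth value of a formula without free propositional variables. -/
def truth (P : Pole) {k : ℕ} (A : Formula k []) (ρ : Fin k → ℕ) : Set Term :=
  P.dual (falsity P A ρ PEnv.empty)

/-- `h` is a continuation for `A` above `π`: it realizes `A → {π}`. -/
def Handles (P : Pole) (π : Stack) {k : ℕ} (A : Formula k []) (ρ : Fin k → ℕ) (h : Term) : Prop :=
  ∀ e ∈ truth P A ρ, (⟨h, .push e π⟩ : Proc) ∈ P.carrier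

section

variable {P : Pole} {k : ℕ} {A B : Formula k []} {ρ : Fin k → ℕ}

theorem mem_truth_or_iff {d : Term} : d ∈ truth P (A.or B) ρ ↔
    ∀ (f g : Term) (π : Stack), Handles P π A ρ f → Handles P π B ρ g →
      (⟨d, .push f (.push g π)⟩ : Proc) ∈ P.carrier := by
  constructor
  · intro hd f g π hf hg
    refine hd _ (Set.mem_iUnion.2 ⟨fun _ => {π}, ?_⟩)
    refine ⟨f, ?_, _, ⟨g, ?_, π, rfl, rfl⟩, rfl⟩
    · rintro _ ⟨e, he, _, rfl, rfl⟩
      rw [falsity_weaken] at he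
      exact hf e he
    · rintro _ ⟨e, he, _, rfl, rfl⟩
      rw [falsity_weaken] at he
      exact hg e he
  · intro h ξ hξ
    obtain ⟨F, f, hf, _, ⟨g, hg, π, hπ, rfl⟩, rfl⟩ := Set.mem_iUnion.1 hξ
    refine h f g π (fun e he => hf _ ⟨e, ?_, π, hπ, rfl⟩) (fun e he => hg _ ⟨e, ?_, π, hπ, rfl⟩)
    · rw [falsity_weaken]; exact he
    · rw [falsity_weaken]; exact he

/-- A realizer of `a = b` may be applied to any `u`, provided that `u` is correct when `a` and `b`
really have the same value: an equation between different values is realized as `⊤ → ⊥`. -/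
theorem mem_carrier_of_mem_truth_eq {a b : FOTerm k} {e u : Term} {π : Stack}
    (he : e ∈ truth P (Formula.eq a b) ρ)
    (hu : a.value ρ = b.value ρ → (⟨u, π⟩ : Proc) ∈ P.carrier) :
    (⟨e, .push u π⟩ : Proc) ∈ P.carrier := by
  refine he _ (Set.mem_iUnion.2 ⟨fun v => {ξ | v 0 = b.value ρ ∧ ξ = π}, ?_⟩)
  refine ⟨u, ?_, π, ⟨rfl, rfl⟩, rfl⟩
  rintro _ ⟨h, rfl⟩
  exact hu h

theorem id_mem_truth_eq {a b : FOTerm k} (h : a.value ρ = b.value ρ) :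
    lam (var 0) ∈ truth P (Formula.eq a b) ρ := by
  intro ξ hξ
  obtain ⟨F, t, ht, π, hπ, rfl⟩ := Set.mem_iUnion.1 hξ
  refine P.anti_eval _ _ (.single (.grab _ _ _)) (ht π ?_)
  simpa [falsity, h] using hπ

end

/-- The term `λe. e f g`, which analyses a realizer of a disjunction. -/
def caseTerm {k : ℕ} (f g : LTerm k) : LTerm k :=
  lam (app (app (var 0) (f.rename Fin.succ)) (g.rename Fin.succ))

theorem eval_caseTerm {k : ℕ} (f g : LTerm k) (s : Fin k → Term) (e : Term) (π : Stack) :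
    Eval ⟨(caseTerm f g).subst s, .push e π⟩
      ⟨e, .push (f.subst s) (.push (g.subst s) π)⟩ := by
  refine (eval_lam_subst _ s e π).trans ?_
  simp only [subst, subst_rename, Fin.cases_zero, Fin.cases_succ]
  exact (Relation.ReflTransGen.single (.push _ _ _)).trans (.single (.push _ _ _))

/-- The injections `λf g. f w` and `λf g. g w` (for the index `1` and `0`) into a disjunction. -/
def injTerm (i : Fin 2) (w : Term) : Term :=
  lams 2 (app (var i) (w.rename Fin.elim0))

theorem eval_injTerm (i : Fin 2) (w f g : Term) (π : Stack) :
    Eval ⟨injTerm i w, .push f (.push g π)⟩ ⟨![g, f] i, .push w π⟩ := by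
  refine (eval_lams (k := 2) _ ![f, g] π).trans ?_
  simp only [subst, subst_rename_closed]
  have h : ![f, g] i.rev = ![g, f] i := by fin_cases i <;> rfl
  rw [h]
  exact .single (.push _ _ _)

/-- Introduction of a disjunction: a proof-like realizer of one of the disjuncts, uniform in the
poles and the assignments satisfying `C`, yields such a realizer of the disjunction. -/
theorem exists_mem_truth_bigOr {k : ℕ} (l : List (BAFormula k))
    (C : Pole → (Fin k → ℕ) → Prop) {A : BAFormula k} (hA : A ∈ l)
    (h : ∃ w : Term, w.ProofLike ∧ ∀ P ρ, C P ρ → w ∈ truth P A.inGimelTwo ρ) :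
    ∃ w : Term, w.ProofLike ∧ ∀ P ρ, C P ρ → w ∈ truth P (BAFormula.bigOr l).inGimelTwo ρ := by
  have inl : ∀ A B : BAFormula k,
      (∃ w : Term, w.ProofLike ∧ ∀ P ρ, C P ρ → w ∈ truth P A.inGimelTwo ρ) →
      ∃ w : Term, w.ProofLike ∧ ∀ P ρ, C P ρ → w ∈ truth P (A.or B).inGimelTwo ρ := by
    rintro A B ⟨w, hw, h⟩
    refine ⟨injTerm 1 w, ⟨trivial, proofLike_rename _ hw⟩, fun P ρ hC => ?_⟩
    exact mem_truth_or_iff.2 fun f g π hf hg =>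
      P.anti_eval _ _ (eval_injTerm 1 w f g π) (hf w (h P ρ hC))
  have inr : ∀ A B : BAFormula k,
      (∃ w : Term, w.ProofLike ∧ ∀ P ρ, C P ρ → w ∈ truth P B.inGimelTwo ρ) →
      ∃ w : Term, w.ProofLike ∧ ∀ P ρ, C P ρ → w ∈ truth P (A.or B).inGimelTwo ρ := by
    rintro A B ⟨w, hw, h⟩
    refine ⟨injTerm 0 w, ⟨trivial, proofLike_rename _ hw⟩, fun P ρ hC => ?_⟩
    exact mem_truth_or_iff.2 fun f g π hf hg =>
      P.anti_eval _ _ (eval_injTerm 0 w f g π) (hg w (h P ρ hC))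
  cases l with
  | nil => simp at hA
  | cons B l =>
    -- The disjunction is associated to the left, so the part already built is the left disjunct.
    have aux : ∀ (l : List (BAFormula k)) (B : BAFormula k), (A ∈ l ∨
        ∃ w : Term, w.ProofLike ∧ ∀ P ρ, C P ρ → w ∈ truth P B.inGimelTwo ρ) →
        ∃ w : Term, w.ProofLike ∧ ∀ P ρ, C P ρ → w ∈ truth P (l.foldl .or B).inGimelTwo ρ := by
      intro l
      induction l with
      | nil => intro B hB; exact hB.resolve_left (by simp)
      | cons D l ih =>
        intro B hB
        refine ih (B.or D) ?_
        rcases hB with hB | hB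
        · rcases List.mem_cons.1 hB with rfl | hB
          · exact Or.inr (inr _ _ h)
          · exact Or.inl hB
        · exact Or.inr (inl _ _ hB)
    refine aux l B ?_
    rcases List.mem_cons.1 hA with rfl | hA
    · exact Or.inr h
    · exact Or.inl hA

/-- Elimination of a disjunction: proof-like continuations for the disjuncts combine into one for
the disjunction. The continuations are open terms, depending on parameters `s`; they need only be
correct for poles, stacks, assignments and parameters satisfying `C`. -/
theorem exists_handles_bigOr {k n : ℕ} (l : List (BAFormula k))
    (C : Pole → Stack → (Fin k → ℕ) → (Fin n → Term) → Prop)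
    (hl : ∀ A ∈ l, ∃ h : LTerm n, h.ProofLike ∧
      ∀ P π ρ s, C P π ρ s → Handles P π A.inGimelTwo ρ (h.subst s)) :
    ∃ h : LTerm n, h.ProofLike ∧
      ∀ P π ρ s, C P π ρ s → Handles P π (BAFormula.bigOr l).inGimelTwo ρ (h.subst s) := by
  cases l with
  | nil =>
    refine ⟨lam (var 0), trivial, fun P π ρ s _ e he => ?_⟩
    exact P.anti_eval _ _ (.single (.grab _ _ _)) (he π trivial)
  | cons B l =>
    simp only [List.forall_mem_cons] at hl
    obtain ⟨hB, hl⟩ := hl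
    simp only [BAFormula.bigOr]
    induction l generalizing B with
    | nil => exact hB
    | cons D l ih =>
      simp only [List.forall_mem_cons] at hl
      obtain ⟨f, hf, hfB⟩ := hB
      obtain ⟨⟨g, hg, hgD⟩, hl⟩ := hl
      refine ih (B.or D) ⟨caseTerm f g, ⟨⟨trivial, proofLike_rename _ hf⟩,
        proofLike_rename _ hg⟩, fun P π ρ s hC e he => ?_⟩ hl
      exact P.anti_eval _ _ (eval_caseTerm f g s e π)
        (mem_truth_or_iff.1 he _ _ _ (hfB P π ρ s hC) (hgD P π ρ s hC))

/-! ### The formula bounding the cardinality of `ℷ2` -/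

theorem mem_truth_all_iff {P : Pole} {k : ℕ} {A : BAFormula (k + 1)} {ρ : Fin k → ℕ} {t : Term} :
    t ∈ truth P A.all.inGimelTwo ρ ↔
      ∀ x : Fin 2, t ∈ truth P A.inGimelTwo (Fin.cons (x : ℕ) ρ) := by
  have hx : ∀ x : ℕ, min (x + 1) 2 = x + 1 ↔ x < 2 := by omega
  simp only [truth, Pole.dual, BAFormula.inGimelTwo, Formula.allGimel, falsity, FOTerm.value,
    Set.mem_iUnion, Set.mem_ofPred_eq, Matrix.cons_val_zero, Matrix.cons_val_one,
    Fin.cons_zero, hx]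
  constructor
  · exact fun h x π hπ => h π ⟨x, x.2, hπ⟩
  · rintro h π ⟨x, hx, hπ⟩
    exact h ⟨x, hx⟩ π hπ

theorem mem_truth_allClosure_iff {P : Pole} {t : Term} : ∀ {k : ℕ} {A : BAFormula k},
    t ∈ truth P (BAFormula.allClosure k A).inGimelTwo Fin.elim0 ↔
      ∀ x : Fin k → Fin 2, t ∈ truth P A.inGimelTwo (fun i => (x i : ℕ))
  | 0, A => by
      have h : ∀ x : Fin 0 → Fin 2, (fun i => (x i : ℕ)) = Fin.elim0 :=
        fun x => Subsingleton.elim _ _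
      simp only [BAFormula.allClosure, h, forall_const]
  | k + 1, A => by
      rw [BAFormula.allClosure, mem_truth_allClosure_iff]
      simp only [mem_truth_all_iff]
      constructor
      · intro h x
        convert h (Fin.tail x) (x 0) using 2
        funext i
        cases i using Fin.cases <;> rfl
      · intro h x y
        convert h (Fin.cons y x) using 2
        funext i
        cases i using Fin.cases <;> rfl

/-- The disjunction stating that two of the variables `x₁, …, xₘ` are equal. -/
def someEq (m : ℕ) : BAFormula m :=
  BAFormula.bigOr (((List.finRange m ×ˢ List.finRange m).filter (fun p => p.1 ≠ p.2)).map
    (fun p => .eq (.var p.1) (.var p.2)))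

theorem realizes_gimelTwoCardLT_iff {P : Pole} {t : Term} {m : ℕ} :
    Realizes P t (gimelTwoCardLT m) ↔
      ∀ x : Fin m → Fin 2, t ∈ truth P (someEq m).inGimelTwo (fun i => (x i : ℕ)) :=
  mem_truth_allClosure_iff

/-! ### Voting instructions and the cardinality of `ℷ2` -/

theorem isVotingInstruction_iff {S : RealizabilityStructure} {n : ℕ} {φ : Term} :
    IsVotingInstruction (evaluationOf S) n φ ↔
      ∀ P ∈ S, ∀ (t : Fin n → Term) (π : Stack) (j : Fin n),
        (∀ i, i ≠ j → (⟨t i, π⟩ : Proc) ∈ P.carrier) →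
        (⟨φ, pushAll t π⟩ : Proc) ∈ P.carrier := by
  constructor
  · intro h P hP t π j ht
    obtain ⟨p, rfl, hp⟩ := h t π j P hP (by rintro p ⟨i, hi, rfl⟩; exact ht i hi)
    exact hp
  · intro h t π j P hP hQ
    exact ⟨_, rfl, h P hP t π j fun i hi => hQ ⟨i, hi, rfl⟩⟩

/-- Distinct subsets `f a` of `Fin n` are given to the variables `xₐ`, so that each `j : Fin n` defines
an assignment. From the equation `xₐ = xₐ'` one votes for an index at which `f a` and `f a'` differ:
if it is the index `j` that is actually used, the equation is realized as `⊤ → ⊥`. -/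
theorem exists_votingInstruction {S : RealizabilityStructure} {n m : ℕ} (hm : m ≤ 2 ^ n)
    (h : gimelTwoCardLT m ∈ theory S) :
    ∃ φ : Term, φ.ProofLike ∧ IsVotingInstruction (evaluationOf S) n φ := by
  obtain ⟨θ, hθ, h⟩ := h
  obtain ⟨f⟩ : Nonempty (Fin m ↪ (Fin n → Fin 2)) :=
    Function.Embedding.nonempty_of_card_le (by simpa using hm)
  obtain ⟨b, hb, hbs⟩ := exists_handles_bigOr (n := n)
    (((List.finRange m ×ˢ List.finRange m).filter (fun p => p.1 ≠ p.2)).map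
      (fun p => .eq (.var p.1) (.var p.2)))
    (fun P π ρ s => ∃ j, ρ = (fun a => (f a j : ℕ)) ∧
      ∀ i, i ≠ j → (⟨s i, π⟩ : Proc) ∈ P.carrier) (by
    intro A hA
    simp only [List.mem_map, List.mem_filter, decide_eq_true_eq] at hA
    obtain ⟨⟨a, a'⟩, ⟨-, haa'⟩, rfl⟩ := hA
    obtain ⟨i, hi⟩ := Function.ne_iff.1 (f.injective.ne haa')
    refine ⟨lam (app (var 0) (var i.succ)), ⟨trivial, trivial⟩, ?_⟩
    rintro P π _ s ⟨j, rfl, hs⟩ e he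
    refine P.anti_eval _ _ ((eval_lam_subst _ s e π).trans (.single (.push _ _ _))) ?_
    refine mem_carrier_of_mem_truth_eq he fun hv => hs i ?_
    rintro rfl
    exact hi (Fin.ext hv))
  refine ⟨lams n (app b (θ.rename Fin.elim0)), proofLike_lams ⟨hb, proofLike_rename _ hθ⟩,
    isVotingInstruction_iff.2 fun P hP t π j ht => ?_⟩
  refine P.anti_eval _ _ ((eval_lams _ t π).trans (.single (.push _ _ _))) ?_
  rw [subst_rename_closed]
  refine hbs P π (fun a => (f a j.rev : ℕ)) _ ⟨j.rev, rfl, fun i hi => ht _ ?_⟩ _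
    (realizes_gimelTwoCardLT_iff.1 (h P hP) fun a => f a j.rev)
  rintro rfl
  exact hi (Fin.rev_rev i).symm

/-- A voting instruction, applied to `n` terms of which all but one belong to a truth value, belongs
to that truth value. -/
theorem apps_voting_mem_dual {S : RealizabilityStructure} {n : ℕ} {φ : Term}
    (hφ : IsVotingInstruction (evaluationOf S) n φ) {P : Pole} (hP : P ∈ S) {X : Set Stack}
    {t : Fin n → Term} (j : Fin n) (ht : ∀ i, i ≠ j → t i ∈ P.dual X) :
    apps φ (List.ofFn t) ∈ P.dual X := fun π hπ =>
  P.anti_eval _ _ (eval_apps _ _ _)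
    (isVotingInstruction_iff.1 hφ P hP t π j fun i hi => ht i hi π hπ)

/-- Fewer than `n` assignments cannot separate more than `2 ^ (n - 1)` variables. -/
theorem exists_ne_forall_eq {m n : ℕ} (hm : 2 ^ (n - 1) < m) {V : Finset (Fin m → Fin 2)}
    (hV : V.card < n) : ∃ a b : Fin m, a ≠ b ∧ ∀ x ∈ V, x a = x b := by
  obtain ⟨a, b, hab, h⟩ := Fintype.exists_ne_map_eq_of_card_lt
    (fun (a : Fin m) (x : V) => x.1 a) (by
      simpa using (Nat.pow_le_pow_right two_pos (Nat.le_sub_one_of_lt hV)).trans_lt hm)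
  exact ⟨a, b, hab, fun x hx => congrFun h ⟨x, hx⟩⟩

/-- The realizer is built by induction on the set `V` of assignments for which it has to be correct.
A set of fewer than `n` assignments satisfies a common equation between two variables; in a larger
one, `n` distinct assignments are chosen, and one votes between the realizers for `V` deprived of
one of them. -/
theorem exists_mem_truth_someEq {S : RealizabilityStructure} {n m : ℕ} (hn : 0 < n)
    (hm : 2 ^ (n - 1) < m) {φ : Term} (hφ : φ.ProofLike)
    (hv : IsVotingInstruction (evaluationOf S) n φ) (V : Finset (Fin m → Fin 2)) :
    ∃ t : Term, t.ProofLike ∧ ∀ P ∈ S, ∀ x ∈ V,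
      t ∈ truth P (someEq m).inGimelTwo (fun i => (x i : ℕ)) := by
  induction V using Finset.strongInduction with
  | H V ih =>
    rcases lt_or_ge V.card n with hV | hV
    · obtain ⟨a, b, hab, h⟩ := exists_ne_forall_eq hm hV
      obtain ⟨w, hw, hwt⟩ := exists_mem_truth_bigOr
        (((List.finRange m ×ˢ List.finRange m).filter (fun p => p.1 ≠ p.2)).map
          (fun p => .eq (.var p.1) (.var p.2)))
        (fun _ ρ => ρ a = ρ b) (A := .eq (.var a) (.var b))
        (List.mem_map.2 ⟨(a, b), by simp [hab], rfl⟩)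
        ⟨lam (var 0), trivial, fun P ρ h => id_mem_truth_eq h⟩
      exact ⟨w, hw, fun P _ x hx => hwt P _ (congrArg Fin.val (h x hx))⟩
    · obtain ⟨W, hWV, hW⟩ := Finset.exists_subset_card_eq hV
      let s : Fin n → Fin m → Fin 2 := fun i => (W.equivFinOfCardEq hW).symm i
      have hs : ∀ i, s i ∈ V := fun i => hWV ((W.equivFinOfCardEq hW).symm i).2
      have hsi : Function.Injective s :=
        Subtype.val_injective.comp (W.equivFinOfCardEq hW).symm.injective
      choose t ht htr using fun i => ih (V.erase (s i)) (Finset.erase_ssubset (hs i))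
      refine ⟨apps φ (List.ofFn t), proofLike_apps hφ (by
        intro u hu
        obtain ⟨i, rfl⟩ := (List.mem_ofFn' t u).1 hu
        exact ht i), fun P hP x hx => ?_⟩
      -- Only the branch which excludes the actual assignment `x` may be wrong.
      obtain ⟨j, hj⟩ : ∃ j, ∀ i, i ≠ j → x ≠ s i := by
        by_cases h : ∃ j, x = s j
        · obtain ⟨j, rfl⟩ := h
          exact ⟨j, fun i hi h => hi (hsi h.symm)⟩
        · exact ⟨⟨0, hn⟩, fun i _ h' => h ⟨i, h'⟩⟩
      exact apps_voting_mem_dual hv hP j fun i hi =>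
        htr i P hP x (Finset.mem_erase.2 ⟨hj i hi, hx⟩)

theorem gimelTwoCardLT_mem_theory {S : RealizabilityStructure} {n m : ℕ} (hn : 0 < n)
    (hm : 2 ^ (n - 1) < m)
    (h : ∃ φ : Term, φ.ProofLike ∧ IsVotingInstruction (evaluationOf S) n φ) :
    gimelTwoCardLT m ∈ theory S := by
  obtain ⟨φ, hφ, hv⟩ := h
  obtain ⟨t, ht, h⟩ := exists_mem_truth_someEq hn hm hφ hv Finset.univ
  exact ⟨t, ht, fun P hP =>
    realizes_gimelTwoCardLT_iff.2 fun x => h P hP x (Finset.mem_univ x)⟩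

end ClassicalRealizability

theorem mainTheorem3 (S : ClassicalRealizability.RealizabilityStructure) (n : ℕ) (hn : 0 < n) :
    (ClassicalRealizability.gimelTwoCardLT (2 ^ n) ∈ ClassicalRealizability.theory S ↔
      ∃ φ : ClassicalRealizability.Term, φ.ProofLike ∧
        ClassicalRealizability.IsVotingInstruction
          (ClassicalRealizability.evaluationOf S) n φ) ∧
    (ClassicalRealizability.gimelTwoCardLE (2 ^ (n - 1)) ∈ ClassicalRealizability.theory S ↔
      ∃ φ : ClassicalRealizability.Term, φ.ProofLike ∧
        ClassicalRealizability.IsVotingInstruction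
          (ClassicalRealizability.evaluationOf S) n φ) := by
  have h : 2 ^ (n - 1) < 2 ^ n := Nat.pow_lt_pow_right one_lt_two (Nat.sub_lt hn one_pos)
  exact ⟨⟨ClassicalRealizability.exists_votingInstruction le_rfl,
      ClassicalRealizability.gimelTwoCardLT_mem_theory hn h⟩,
    ⟨ClassicalRealizability.exists_votingInstruction h,
      ClassicalRealizability.gimelTwoCardLT_mem_theory hn (Nat.lt_succ_self _)⟩⟩
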